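/- Let $X$ be a connected smooth $4$-manifold with basepoint $x_0$ (possibly non-compact, possibly with boundary), let $T_X=\{g\in\pi_1(X,x_0): g^2=1,\ g\ne 1\}$, let $\mathbb F_2T_X$ be the $\mathbb F_2$-vector space with basis $T_X$, and let $\pi:(\widetilde X,\tilde x_0)\to (X,x_0)$ be the universal cover, on which $\pi_1(X,x_0)$ acts by deck transformations. Call a smooth map from a compact $3$-manifold to a $6$-manifold \emph{generic} if it is an immersion, takes interior points to interior points, has no triple points, and its two sheets meet transversally at every double point. Let $V$ be a smooth $2$-manifold ($V=\mathbb R^2$ or $V=\mathbb R\times I$, with $I=[0,1]$), let $M=S^3$ or $M=S^2\times I$, and let $F:M\to X\times V$ be generic, taking the basepoint $m_0$ of $M$ into $\{x_0\}\times V$. To a double point $p=F(x)=F(y)$, $x\neq y$, assign the class $g_p\in\pi_1(X,x_0)$ of the projection to $X$ of the loop $F(a)\,F(b)\,\overline{F(a)}$, where $a$ is an arc in $M$ from $m_0$ to $x$ and $b$ is an arc in $M$ from $x$ to $y$; up to inversion $g_p$ depends only on $p$. Put $\Sigma(F)=\sum_{p:\,g_p\in T_X} g_p\in\mathbb F_2T_X$,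 the sum over the double points of $F$ with $g_p\in T_X$. For a generic map $f:S^3\to X\times\mathbb R^2$ taking the basepoint of $S^3$ into $\{x_0\}\times\mathbb R^2$ (for instance a generic perturbation of a based map $S^3\to X$) let $\mu_3(f)=\Sigma(f)$, and let $\mu_3(\pi_3(X))\subset\mathbb F_2T_X$ be the subspace spanned by all these elements. For based smooth embeddings $S_0,S_1:S^2\to X$ with image in the interior of $X$ and a generic map $H:S^2\times I\to X\times\mathbb R\times I$ with $H(z,0)=(S_0(z),0,0)$, $H(z,1)=(S_1(z),0,1)$ and $H(\{*\}\times I)\subset\{x_0\}\times\mathbb R\times I$ (for instance a generic perturbation of the track of a based homotopy from $S_0$ to $S_1$), let $\mathrm{fq}(S_0,S_1)$ be the class of $\Sigma(H)$ in $\mathbb F_2T_X/\mu_3(\pi_3(X))$, that is, the Freedman--Quinn invariant as computed from $H$. (a) Let $f$ be as above, let $Y_1\subset\widetilde X\times\mathbb R^2$ be the image of the lift of $f$ that takes the basepoint of $S^3$ into $\{\tilde x_0\}\times\mathbb R^2$, and let $Y_g=g\cdot Y_1$ for $g\in\pi_1(X,x_0)$. Then the double points of $f$ and of its lift are isolated and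 finite in number; for every $g\ne1$ the set $Y_1\cap Y_g$ is finite, and it is empty for all but finitely many $g\neq 1$; for $g\in T_X$ the number $|Y_1\cap Y_g|$ is even; and $$\mu_3(f)=\sum_{g\in T_X}\tfrac12|Y_1\cap Y_g|\cdot g\in\mathbb F_2T_X .$$ (b) Let $S_0,S_1,H$ be as above, let $Y_1\subset\widetilde X\times\mathbb R\times I$ be the image of the lift of $H$ that takes $(*,0)$ into $\{\tilde x_0\}\times\mathbb R\times I$, and let $Y_g=g\cdot Y_1$. Then the same finiteness and parity statements hold, and $$\mathrm{fq}(S_0,S_1)=\sum_{g\in T_X}\tfrac12|Y_1\cap Y_g|\cdot g\in\mathbb F_2T_X/\mu_3(\pi_3(X)) .$$ -/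

import Mathlib

open scoped Manifold ContDiff

noncomputable section

namespace FreedmanQuinn

/-- The standard `n`-sphere. -/
abbrev Sph (n : ℕ) : Type := Metric.sphere (0 : EuclideanSpace ℝ (Fin (n + 1))) 1

instance factFinrank (n : ℕ) :
    Fact (Module.finrank ℝ (EuclideanSpace ℝ (Fin (n + 1))) = n + 1) :=
  ⟨finrank_euclideanSpace_fin⟩

/-- The basepoint of the `n`-sphere. -/
def pole (n : ℕ) : Sph n := ⟨EuclideanSpace.single 0 1, by simp⟩

instance pathConnectedSph (n : ℕ) : PathConnectedSpace (Sph (n + 1)) := by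
  refine isPathConnected_iff_pathConnectedSpace.mp (isPathConnected_sphere ?_ 0 zero_le_one)
  rw [← Module.finrank_eq_rank, finrank_euclideanSpace_fin]
  exact_mod_cast (by omega : 1 < n + 1 + 1)

instance pathConnectedCylinder (n : ℕ) : PathConnectedSpace (Sph (n + 1) × unitInterval) := by
  have hI : PathConnectedSpace unitInterval := isPathConnected_iff_pathConnectedSpace.mp
    ((convex_Icc (0 : ℝ) 1).isPathConnected ⟨0, by simp⟩)
  refine ⟨inferInstance, fun p q => ?_⟩
  exact ⟨(PathConnectedSpace.somePath p.1 q.1).prod (PathConnectedSpace.somePath p.2 q.2)⟩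

/-! ### Generic maps -/

section Generic

variable {E H M E' H' N : Type*}
  [NormedAddCommGroup E] [NormedSpace ℝ E] [TopologicalSpace H]
  [TopologicalSpace M] [ChartedSpace H M]
  [NormedAddCommGroup E'] [NormedSpace ℝ E'] [TopologicalSpace H']
  [TopologicalSpace N] [ChartedSpace H' N]

/-- The image of the tangent space at `m` under the derivative of `F`, as a subspace of the model
vector space of `N` (which is the tangent space of `N` at `F m`). -/
def tangentImage (J : ModelWithCorners ℝ E H) (K : ModelWithCorners ℝ E' H') (F : M → N) (m : M) :
    Submodule ℝ E' :=
  LinearMap.range (mfderiv J K F m : E →L[ℝ] E').toLinearMap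

/-- Generic maps in the range of dimensions `3 → 6`: smooth immersions whose only
multiple points are transverse double points. Interior points go to interior points. -/
structure IsGeneric (J : ModelWithCorners ℝ E H) (K : ModelWithCorners ℝ E' H') (F : M → N) :
    Prop where
  smooth : ContMDiff J K ∞ F
  immersion : ∀ m, Function.Injective (mfderiv J K F m)
  transverse : ∀ x y, x ≠ y → F x = F y → tangentImage J K F x ⊔ tangentImage J K F y = ⊤
  no_triple : ∀ x y z, F x = F y → F y = F z → x = y ∨ y = z ∨ x = z
  interior : ∀ m, J.IsInteriorPoint m → K.IsInteriorPoint (F m)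

end Generic

/-- The double points of a map, as points of its image. -/
def doublePoints {M N : Type*} (F : M → N) : Set N :=
  {p | ∃ x y, x ≠ y ∧ F x = p ∧ F y = p}

/-! ### The 2-torsion subset and self-intersection sums -/

section Pi1

variable {X : Type*} [TopologicalSpace X]

/-- `T_X`, the elements of order exactly two in `π₁(X, x₀)`. -/
def twoTorsion (x₀ : X) : Set (FundamentalGroup X x₀) := {g | g ^ 2 = 1 ∧ g ≠ 1}

/-- `𝔽₂ T_X`, the `𝔽₂`-vector space with basis `T_X`. -/
abbrev F2T (x₀ : X) : Type _ := twoTorsion x₀ →₀ ZMod 2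

variable {M V : Type*} [TopologicalSpace M] [PathConnectedSpace M] [TopologicalSpace V]

/-- The based loop in `X` of a double point `F x = F y`: an arc `a` from the basepoint `m₀` to `x`,
an arc `b` from `x` to `y`, and the image of `a` backwards. -/
def doubleLoop (F : C(M, X × V)) {m₀ : M} {x₀ : X} (h₀ : (F m₀).1 = x₀) {x y : M}
    (hxy : F x = F y) (a : Path m₀ x) (b : Path x y) : Path x₀ x₀ :=
  let φ : C(M, X) := ContinuousMap.fst.comp F
  ((a.map φ.continuous).trans
    ((b.map φ.continuous).trans
      ((a.symm.map φ.continuous).cast (congrArg Prod.fst hxy.symm) rfl))).cast h₀.symm h₀.symm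

/-- The element `g_p` of `π₁(X, x₀)` of a double point `p` of `F`, for a choice of order of the two
preimages and of arcs. -/
def doubleElt (F : C(M, X × V)) {m₀ : M} {x₀ : X} (h₀ : (F m₀).1 = x₀) (p : doublePoints F) :
    FundamentalGroup X x₀ :=
  let x := p.2.choose
  let y := p.2.choose_spec.choose
  have h := p.2.choose_spec.choose_spec
  FundamentalGroup.fromPath <| Path.Homotopic.Quotient.mk <|
    doubleLoop F h₀ (x := x) (y := y) (h.2.1.trans h.2.2.symm)
      (PathConnectedSpace.somePath m₀ x) (PathConnectedSpace.somePath x y)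

open Classical in
/-- The self-intersection sum `∑ g_p ∈ 𝔽₂ T_X` over the double points `p` of `F` with
`g_p ∈ T_X`. (Exchanging the two preimages of `p` inverts `g_p`, so the summand is well defined; in
`ℤπ₁(X) / ⟨g + g⁻¹, 1⟩` the double points with `g_p² ≠ 1` cancel by sign.) -/
def selfIntersection (F : C(M, X × V)) {m₀ : M} {x₀ : X} (h₀ : (F m₀).1 = x₀) : F2T x₀ :=
  ∑ᶠ p : doublePoints F,
    if h : doubleElt F h₀ p ∈ twoTorsion x₀ then
      Finsupp.single (⟨doubleElt F h₀ p, h⟩ : twoTorsion x₀) (1 : ZMod 2)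
    else 0

end Pi1

/-! ### `μ₃` and `fq` -/

section Invariants

variable {HX X : Type*} [TopologicalSpace HX] [TopologicalSpace X] [ChartedSpace HX X]

/-- `ℝ²`. -/
abbrev Plane : Type := EuclideanSpace ℝ (Fin 2)

/-- A generic based map `S³ → X × ℝ²`. -/
structure IsGenericSphere (I : ModelWithCorners ℝ (EuclideanSpace ℝ (Fin 4)) HX) (x₀ : X)
    (f : C(Sph 3, X × Plane)) : Prop where
  generic : IsGeneric (𝓡 3) (I.prod (𝓡 2)) f
  based : (f (pole 3)).1 = x₀

/-- `μ₃(f)`, computed from the generic based map `f : S³ → X × ℝ²`. -/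
def mu3 {I : ModelWithCorners ℝ (EuclideanSpace ℝ (Fin 4)) HX} {x₀ : X}
    {f : C(Sph 3, X × Plane)} (hf : IsGenericSphere I x₀ f) : F2T x₀ :=
  selfIntersection f hf.based

/-- The subspace `μ₃(π₃(X))` of `𝔽₂ T_X`. Every element of `π₃(X)` is represented by
(the first component of) a generic based map `S³ → X × ℝ²`. -/
def mu3Image (I : ModelWithCorners ℝ (EuclideanSpace ℝ (Fin 4)) HX) (x₀ : X) :
    Submodule (ZMod 2) (F2T x₀) :=
  Submodule.span (ZMod 2) {v | ∃ f, ∃ hf : IsGenericSphere I x₀ f, mu3 hf = v}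

/-- A smoothly embedded based 2-sphere in (the interior of) `X`. -/
structure IsBasedSphere (I : ModelWithCorners ℝ (EuclideanSpace ℝ (Fin 4)) HX) (x₀ : X)
    (S : Sph 2 → X) : Prop where
  embedding : Manifold.IsSmoothEmbedding (𝓡 2) I ∞ S
  interior : ∀ z, I.IsInteriorPoint (S z)
  based : S (pole 2) = x₀

/-- A generic based map `H : S² × I → X × ℝ × I` from `S₀ × 0 × 0` to `S₁ × 0 × 1`, such as a
generic perturbation of the track of a based homotopy. -/
structure IsGenericTrack (I : ModelWithCorners ℝ (EuclideanSpace ℝ (Fin 4)) HX) (x₀ : X)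
    (S₀ S₁ : Sph 2 → X) (H : C(Sph 2 × unitInterval, X × (ℝ × unitInterval))) : Prop where
  generic : IsGeneric ((𝓡 2).prod (𝓡∂ 1)) (I.prod (𝓘(ℝ, ℝ).prod (𝓡∂ 1))) H
  start : ∀ z, H (z, 0) = (S₀ z, 0, 0)
  finish : ∀ z, H (z, 1) = (S₁ z, 0, 1)
  based : ∀ t, (H (pole 2, t)).1 = x₀

/-- `fq(S₀, S₁) ∈ 𝔽₂ T_X / μ₃(π₃(X))`, computed from the generic track `H`. -/
def fq {I : ModelWithCorners ℝ (EuclideanSpace ℝ (Fin 4)) HX} {x₀ : X}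
    {S₀ S₁ : Sph 2 → X} {H : C(Sph 2 × unitInterval, X × (ℝ × unitInterval))}
    (hH : IsGenericTrack I x₀ S₀ S₁ H) : F2T x₀ ⧸ mu3Image I x₀ :=
  (mu3Image I x₀).mkQ (selfIntersection H (m₀ := (pole 2, 0)) (hH.based 0))

end Invariants

/-! ### Lifts to the universal cover -/

section Cover

variable {X Xt : Type*} [TopologicalSpace X] [TopologicalSpace Xt]

/-- The action of `g ∈ π₁(X, x₀)` on the universal cover `(Xt, xt₀)` by deck transformations: `z` is
sent to the endpoint of the lift, starting at `xt₀`, of `g` followed by the projection of a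
path from `xt₀` to `z`. -/
def deck [SimplyConnectedSpace Xt] {π : Xt → X} (hπ : IsCoveringMap π) {xt₀ : Xt} {x₀ : X}
    (h₀ : π xt₀ = x₀) (g : FundamentalGroup X x₀) (z : Xt) : Xt :=
  let γ : Path x₀ x₀ := Quotient.out (FundamentalGroup.toPath g)
  let α : Path x₀ (π z) :=
    ((PathConnectedSpace.somePath xt₀ z).map hπ.continuous).cast h₀.symm rfl
  hπ.liftPath (γ.trans α : Path x₀ (π z)).toContinuousMap xt₀ ((γ.trans α).source.trans h₀.symm) 1

variable {M V : Type*} [TopologicalSpace M] [TopologicalSpace V]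

/-- `Ft` is the lift of `F` to `Xt × V` that takes the basepoint `m₀` to (a point over) `xt₀`. -/
structure IsBasedLift (π : Xt → X) (xt₀ : Xt) (m₀ : M) (F : C(M, X × V)) (Ft : C(M, Xt × V)) :
    Prop where
  lifts : ∀ m, Prod.map π id (Ft m) = F m
  based : (Ft m₀).1 = xt₀

variable [SimplyConnectedSpace Xt] {π : Xt → X} (hπ : IsCoveringMap π) {xt₀ : Xt} {x₀ : X}
  (h₀ : π xt₀ = x₀)

/-- `Y_g = g · Y_1`, where `Y_1` is the image of the based lift `Ft`. -/
def translate (Ft : C(M, Xt × V)) (g : FundamentalGroup X x₀) : Set (Xt × V) :=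
  Prod.map (deck hπ h₀ g) id '' Set.range Ft

/-- `Y_1 ∩ Y_g`. -/
def meet (Ft : C(M, Xt × V)) (g : FundamentalGroup X x₀) : Set (Xt × V) :=
  Set.range Ft ∩ translate hπ h₀ Ft g

/-- The double points of `F` and of its lifts are isolated (the spaces being Hausdorff and the
source compact: there are finitely many), and the number of points of `Y_1 ∩ Y_g` is even for every
`g ∈ T_X`. -/
structure HasIsolatedDoublePoints (F : C(M, X × V)) (Ft : C(M, Xt × V)) : Prop where
  base : (doublePoints F).Finite
  lift : (doublePoints Ft).Finite
  meet_finite : ∀ g : FundamentalGroup X x₀, g ≠ 1 → (meet hπ h₀ Ft g).Finite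
  finitely_many : {g : FundamentalGroup X x₀ | g ≠ 1 ∧ (meet hπ h₀ Ft g).Nonempty}.Finite
  meet_even : ∀ g ∈ twoTorsion x₀, Even (meet hπ h₀ Ft g).ncard

/-- `∑_{g ∈ T_X} ½ |Y_1 ∩ Y_g| · g ∈ 𝔽₂ T_X`. -/
def coverSum (Ft : C(M, Xt × V)) : F2T x₀ :=
  ∑ᶠ g : twoTorsion x₀, Finsupp.single g (((meet hπ h₀ Ft g.1).ncard / 2 : ℕ) : ZMod 2)

end Cover

end FreedmanQuinn

end

open FreedmanQuinn

open Set Filter Topology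

/-! ### Local injectivity of immersions and finiteness of transverse double points -/

section LocalInjectivity

variable {E E' : Type*} [NormedAddCommGroup E] [NormedSpace ℝ E] [FiniteDimensional ℝ E]
  [NormedAddCommGroup E'] [NormedSpace ℝ E']

/-! Finiteness is local analysis plus compactness. Near the diagonal of M × M an immersion has no
double pairs, and since 6 = 3 + 3 a transverse double pair is isolated; so the ordered double pairs
have no accumulation point in M × M (`finite_doublePairs`).

The rest is counting in the universal cover. The lift of the loop of a double point with preimages
x, y shows that g_p carries Ft x to Ft y (`deck_doubleLoop`), and by freeness no other element does.
Hence for g ≠ 1 the points of Y_1 ∩ Y_g are the Ft y with (x, y) an ordered double pair and g · Ft x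
= Ft y; without triple points distinct pairs give distinct points. Reversing a pair inverts its
element, so for an involution g both orders count, and |Y_1 ∩ Y_g| is twice the number of double
points with element g (`ncard_meet`). Halving and reducing mod 2 gives the formula for μ₃, and that
for fq after passing to the quotient. -/

/-- A map that is `C¹` within a convex set at a point, with injective derivative there, is injective
near the point. -/
theorem exists_injOn_of_injective_fderivWithin {f : E → E'} {s : Set E} {x : E}
    (hf : ContDiffWithinAt ℝ 1 f s x) (hs : Convex ℝ s) (hu : UniqueDiffOn ℝ s) (hx : x ∈ s)
    (hinj : Function.Injective (fderivWithin ℝ f s x)) : ∃ t ∈ 𝓝[s] x, InjOn f t := by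
  obtain ⟨K, hK0, hK⟩ :=
    (fderivWithin ℝ f s x : E →ₗ[ℝ] E').injective_iff_antilipschitz.mp hinj
  set φ := fderivWithin ℝ f s x with hφ
  have hder : ∀ᶠ y in 𝓝[s] x,
      HasFDerivWithinAt (fun y => f y - φ y) (fderivWithin ℝ f s y - φ) s y := by
    have h1 := hf.eventually (by simp)
    rw [insert_eq_of_mem hx] at h1
    filter_upwards [h1] with y hy
    exact ((hy.differentiableWithinAt one_ne_zero).hasFDerivWithinAt).sub φ.hasFDerivWithinAt
  have hcont : ContinuousWithinAt (fun y => fderivWithin ℝ f s y - φ) s x :=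
    ((hf.fderivWithin_right hu (m := 0) (by simp) hx).continuousWithinAt).sub
      continuousWithinAt_const
  have hpos : 0 < K⁻¹ := inv_pos.mpr hK0
  -- The derivative of f - φ vanishes at x, so near x this map is Lipschitz with constant K⁻¹ / 2,
  -- by the mean value inequality on the convex set s. But φ expands distances by at least K⁻¹, so f
  -- a = f b forces a = b.
  obtain ⟨t, ht, hL⟩ := hs.exists_nhdsWithin_lipschitzOnWith_of_hasFDerivWithinAt_of_nnnorm_lt
    hder hcont (K⁻¹ / 2) (by simpa [hφ] using hpos)
  refine ⟨t, ht, fun a ha b hb hab => ?_⟩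
  by_contra hne
  have h1 := hL.dist_le_mul a ha b hb
  have h2 := hK.le_mul_dist a b
  have h3 : dist (f a - φ a) (f b - φ b) = dist (φ a) (φ b) := by
    rw [hab, dist_sub_left]
  rw [h3] at h1
  have hd : 0 < dist a b := dist_pos.mpr hne
  have hK0' : (0 : ℝ) < K := hK0
  have h4 : dist a b ≤ K * (((K : ℝ)⁻¹ / 2) * dist a b) :=
    h2.trans (mul_le_mul_of_nonneg_left (by exact_mod_cast h1) hK0'.le)
  have h5 : (K : ℝ) * (((K : ℝ)⁻¹ / 2) * dist a b) = dist a b / 2 := by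
    field_simp
  linarith

/-- Two `C¹` maps with transverse derivatives in complementary dimensions have an isolated
coincidence. -/
theorem exists_nhdsWithin_prod_eq_of_transverse [FiniteDimensional ℝ E']
    (hdim : Module.finrank ℝ E' = 2 * Module.finrank ℝ E) {f₁ f₂ : E → E'} {s : Set E} {u v : E}
    (h₁ : ContDiffWithinAt ℝ 1 f₁ s u) (h₂ : ContDiffWithinAt ℝ 1 f₂ s v)
    (hs : Convex ℝ s) (hsu : UniqueDiffOn ℝ s) (hu : u ∈ s) (hv : v ∈ s) (huv : f₁ u = f₂ v)
    (htr : LinearMap.range (fderivWithin ℝ f₁ s u).toLinearMap ⊔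
      LinearMap.range (fderivWithin ℝ f₂ s v).toLinearMap = ⊤) :
    ∃ t ∈ 𝓝[s ×ˢ s] (u, v), ∀ q ∈ t, f₁ q.1 = f₂ q.2 → q = (u, v) := by
  set A := fderivWithin ℝ f₁ s u
  set B := fderivWithin ℝ f₂ s v
  let G : E × E → E' := fun q => f₁ q.1 - f₂ q.2
  have hfst : MapsTo Prod.fst (s ×ˢ s) s := fun q hq => hq.1
  have hsnd : MapsTo Prod.snd (s ×ˢ s) s := fun q hq => hq.2
  have hG : ContDiffWithinAt ℝ 1 G (s ×ˢ s) (u, v) :=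
    (ContDiffWithinAt.comp (u, v) h₁ contDiffWithinAt_fst hfst).sub
      (ContDiffWithinAt.comp (u, v) h₂ contDiffWithinAt_snd hsnd)
  have hGu : UniqueDiffOn ℝ (s ×ˢ s) := hsu.prod hsu
  have hmem : (u, v) ∈ s ×ˢ s := ⟨hu, hv⟩
  have hd₁ : HasFDerivWithinAt f₁ A s u :=
    (h₁.differentiableWithinAt one_ne_zero).hasFDerivWithinAt
  have hd₂ : HasFDerivWithinAt f₂ B s v :=
    (h₂.differentiableWithinAt one_ne_zero).hasFDerivWithinAt
  have hGd : HasFDerivWithinAt G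
      (A.comp (ContinuousLinearMap.fst ℝ E E) - B.comp (ContinuousLinearMap.snd ℝ E E))
      (s ×ˢ s) (u, v) :=
    (HasFDerivWithinAt.comp (u, v) (f := Prod.fst) hd₁ hasFDerivWithinAt_fst hfst).sub
      (HasFDerivWithinAt.comp (u, v) (f := Prod.snd) hd₂ hasFDerivWithinAt_snd hsnd)
  -- Transversality says that (a, b) ↦ A a - B b is surjective; equal dimensions make it injective.
  have hGinj : Function.Injective (fderivWithin ℝ G (s ×ˢ s) (u, v)) := by
    rw [hGd.fderivWithin (hGu _ hmem)]
    set C : E × E →L[ℝ] E' :=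
      A.comp (ContinuousLinearMap.fst ℝ E E) - B.comp (ContinuousLinearMap.snd ℝ E E) with hC
    have hfin : Module.finrank ℝ (E × E) = Module.finrank ℝ E' := by
      rw [Module.finrank_prod, hdim, two_mul]
    refine (LinearMap.injective_iff_surjective_of_finrank_eq_finrank
      (f := (C : E × E →ₗ[ℝ] E')) hfin).mpr fun w => ?_
    have hw : w ∈ LinearMap.range A.toLinearMap ⊔ LinearMap.range B.toLinearMap :=
      htr ▸ Submodule.mem_top
    obtain ⟨_, ⟨a, rfl⟩, _, ⟨b, rfl⟩, hab⟩ := Submodule.mem_sup.mp hw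
    refine ⟨(a, -b), ?_⟩
    simpa [hC] using hab
  obtain ⟨t, ht, hinj⟩ :=
    exists_injOn_of_injective_fderivWithin hG (hs.prod hs) hGu hmem hGinj
  refine ⟨t, ht, fun q hq hqe => hinj hq (mem_of_mem_nhdsWithin hmem ht) ?_⟩
  simp [G, hqe, huv]

end LocalInjectivity

namespace FreedmanQuinn

section Finiteness

variable {E H M E' H' N : Type*}
  [NormedAddCommGroup E] [NormedSpace ℝ E] [TopologicalSpace H]
  [TopologicalSpace M] [ChartedSpace H M]
  [NormedAddCommGroup E'] [NormedSpace ℝ E'] [TopologicalSpace H']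
  [TopologicalSpace N] [ChartedSpace H' N]
  {J : ModelWithCorners ℝ E H} {K : ModelWithCorners ℝ E' H'} {F : M → N}

/-- The ordered pairs of distinct points with the same image. -/
def doublePairs {M N : Type*} (F : M → N) : Set (M × M) := {q | q.1 ≠ q.2 ∧ F q.1 = F q.2}

/-- Neighbourhoods relative to `range J` pull back to neighbourhoods in M, so boundary points need
no separate treatment. -/
theorem extChartAt_tendsto_nhdsWithin_range (J : ModelWithCorners ℝ E H) (x : M) :
    Tendsto (extChartAt J x) (𝓝 x) (𝓝[range J] (extChartAt J x x)) :=
  tendsto_nhdsWithin_iff.mpr ⟨continuousAt_extChartAt x,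
    mem_of_superset (extChartAt_source_mem_nhds (I := J) x) fun _ hy =>
      extChartAt_target_subset_range x ((extChartAt J x).map_source hy)⟩

namespace IsGeneric

theorem contDiffWithinAt (hF : IsGeneric J K F) (x : M) :
    ContDiffWithinAt ℝ 1 (writtenInExtChartAt J K x F) (range J) (extChartAt J x x) :=
  ((contMDiffAt_iff.mp (hF.smooth x)).2).of_le (by exact_mod_cast le_top)

theorem mfderiv_eq (hF : IsGeneric J K F) (x : M) :
    mfderiv J K F x =
      fderivWithin ℝ (writtenInExtChartAt J K x F) (range J) (extChartAt J x x) :=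
  -- `mfderiv` is defined by cases, with value zero where the map is not differentiable.
  if_pos ((hF.smooth x).mdifferentiableAt (by simp))

theorem exists_injOn_nhds [FiniteDimensional ℝ E] (hF : IsGeneric J K F) (x : M) :
    ∃ t ∈ 𝓝 x, InjOn F t := by
  obtain ⟨u, hu, hinj⟩ := exists_injOn_of_injective_fderivWithin (hF.contDiffWithinAt x)
    J.convex_range J.uniqueDiffOn (by simp [extChartAt])
    (by rw [← hF.mfderiv_eq x]; exact hF.immersion x)
  refine ⟨extChartAt J x ⁻¹' u ∩ (extChartAt J x).source,
    inter_mem (extChartAt_tendsto_nhdsWithin_range J x hu) (extChartAt_source_mem_nhds x), ?_⟩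
  rintro a ⟨ha, ha'⟩ b ⟨hb, hb'⟩ hab
  refine (extChartAt J x).injOn ha' hb' (hinj ha hb ?_)
  simp only [writtenInExtChartAt, Function.comp_apply, (extChartAt J x).left_inv ha',
    (extChartAt J x).left_inv hb', hab]

/-- In complementary dimensions, transverse double pairs are isolated. -/
theorem exists_nhds_doublePairs_subset [FiniteDimensional ℝ E] [FiniteDimensional ℝ E']
    (hdim : Module.finrank ℝ E' = 2 * Module.finrank ℝ E) (hF : IsGeneric J K F) {x y : M}
    (hne : x ≠ y) (hxy : F x = F y) : ∃ t ∈ 𝓝 (x, y), doublePairs F ∩ t ⊆ {(x, y)} := by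
  have htr : LinearMap.range (fderivWithin ℝ (writtenInExtChartAt J K x F) (range J)
        (extChartAt J x x)).toLinearMap ⊔ LinearMap.range (fderivWithin ℝ
        (writtenInExtChartAt J K y F) (range J) (extChartAt J y y)).toLinearMap = ⊤ := by
    rw [← hF.mfderiv_eq x, ← hF.mfderiv_eq y]
    exact hF.transverse x y hne hxy
  obtain ⟨u, hu, huniq⟩ := exists_nhdsWithin_prod_eq_of_transverse hdim (hF.contDiffWithinAt x)
    (hF.contDiffWithinAt y) J.convex_range J.uniqueDiffOn (by simp [extChartAt])
    (by simp [extChartAt])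
    (by simp only [writtenInExtChartAt, Function.comp_apply, extChartAt_to_inv, hxy]) htr
  have hT : Tendsto (Prod.map (extChartAt J x) (extChartAt J y)) (𝓝 (x, y))
      (𝓝[range J ×ˢ range J] (extChartAt J x x, extChartAt J y y)) := by
    rw [nhds_prod_eq, nhdsWithin_prod_eq]
    exact (extChartAt_tendsto_nhdsWithin_range J x).prodMap
      (extChartAt_tendsto_nhdsWithin_range J y)
  refine ⟨Prod.map (extChartAt J x) (extChartAt J y) ⁻¹' u ∩
    (extChartAt J x).source ×ˢ (extChartAt J y).source, inter_mem (hT hu)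
      (prod_mem_nhds (extChartAt_source_mem_nhds x) (extChartAt_source_mem_nhds y)), ?_⟩
  rintro ⟨a, b⟩ ⟨⟨-, hab⟩, hu', ha, hb⟩
  dsimp only at hab ha hb
  -- Since F x = F y, both local expressions use the same chart of N, applied to the equal points F
  -- a and F b.
  have h := Prod.ext_iff.mp (huniq _ hu' (by
    simp only [writtenInExtChartAt, Function.comp_apply, Prod.map_apply,
      (extChartAt J x).left_inv ha, (extChartAt J y).left_inv hb, hab, hxy]))
  exact Prod.ext ((extChartAt J x).injOn ha (mem_extChartAt_source x) h.1)
    ((extChartAt J y).injOn hb (mem_extChartAt_source y) h.2)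

/-- A generic map from a compact manifold in complementary dimensions has finitely many pairs of
distinct points with the same image. -/
theorem finite_doublePairs [FiniteDimensional ℝ E] [FiniteDimensional ℝ E']
    [CompactSpace M] [T2Space N]
    (hdim : Module.finrank ℝ E' = 2 * Module.finrank ℝ E) (hF : IsGeneric J K F) :
    (doublePairs F).Finite := by
  by_contra hinf
  -- Compactness of M × M gives an accumulation point, which may lie on the diagonal or off the
  -- coincidence set.
  obtain ⟨⟨x, y⟩, hacc⟩ := Set.Infinite.exists_accPt_principal hinf
  suffices h : ∃ t ∈ 𝓝 (x, y), doublePairs F ∩ t ⊆ {(x, y)} by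
    obtain ⟨t, ht, hsub⟩ := h
    obtain ⟨q, ⟨hqt, hq⟩, hne⟩ := accPt_iff_nhds.mp hacc t ht
    exact hne (hsub ⟨hq, hqt⟩)
  by_cases hxy : F x = F y
  · rcases eq_or_ne x y with rfl | hne
    · obtain ⟨t, ht, hinj⟩ := hF.exists_injOn_nhds x
      exact ⟨t ×ˢ t, prod_mem_nhds ht ht, fun q hq =>
        (hq.1.1 (hinj hq.2.1 hq.2.2 hq.1.2)).elim⟩
    · exact hF.exists_nhds_doublePairs_subset hdim hne hxy
  · have hcont := hF.smooth.continuous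
    have hclosed : IsClosed {q : M × M | F q.1 = F q.2} :=
      isClosed_eq (hcont.comp continuous_fst) (hcont.comp continuous_snd)
    exact ⟨_, hclosed.isOpen_compl.mem_nhds hxy, fun q hq => (hq.2 hq.1.2).elim⟩

end IsGeneric

end Finiteness

end FreedmanQuinn

/-! ### Deck transformations through monodromy -/

namespace Path.Homotopic.Quotient

variable {X : Type*} [TopologicalSpace X] {u v w : X}

theorem trans_right_cancel {a b : Path.Homotopic.Quotient u v} {c : Path.Homotopic.Quotient v w}
    (h : a.trans c = b.trans c) : a = b := by
  have := congrArg (fun q => q.trans c.symm) h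
  simpa [trans_assoc] using this

theorem cast_injective {u' v' : X} (hu : u' = u) (hv : v' = v) :
    Function.Injective fun a : Path.Homotopic.Quotient u v => a.cast hu hv := by
  subst hu hv
  intro a b h
  simpa using h

/-- For the loop a b a⁻¹ of a double point, following it by a leaves a b, whose lift ends on the
other sheet. -/
theorem conj_trans_cancel (a : Path.Homotopic.Quotient u v) (b : Path.Homotopic.Quotient v w)
    (h : w = v) :
    (a.trans (b.trans (a.symm.cast h rfl))).trans a = (a.trans b).cast rfl h.symm := by
  subst h
  simp [trans_assoc]

end Path.Homotopic.Quotient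

namespace IsCoveringMap

variable {X Xt : Type*} [TopologicalSpace X] [TopologicalSpace Xt] {π : Xt → X}
  (hπ : IsCoveringMap π)

theorem coe_monodromy_cast {x y y' : X} (γ : Path.Homotopic.Quotient x y) (h : y' = y)
    (e : π ⁻¹' {x}) : (hπ.monodromy (γ.cast rfl h) e : Xt) = hπ.monodromy γ e := by
  subst h
  simp

/-- Classes of paths with simply connected total space are determined by the endpoints of their
lifts. -/
theorem eq_of_monodromy_eq [SimplyConnectedSpace Xt] {x y : X} {γ γ' : Path.Homotopic.Quotient x y}
    {e : π ⁻¹' {x}} (h : hπ.monodromy γ e = hπ.monodromy γ' e) : γ = γ' := by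
  -- Upstairs there is only one path class between two given points, so every δ is the projection of
  -- the class of the chosen path.
  have key : ∀ (δ : Path.Homotopic.Quotient x y) (w : π ⁻¹' {y}), hπ.monodromy δ e = w →
      δ.cast e.2 w.2 = Path.Homotopic.Quotient.map
        (Path.Homotopic.Quotient.mk (PathConnectedSpace.somePath e.1 w.1))
        ⟨π, hπ.continuous⟩ := by
    rintro δ _ rfl
    rw [← hπ.map_liftPathQuotient]
    congr 1
    exact Subsingleton.elim _ _
  exact Path.Homotopic.Quotient.cast_injective _ _ ((key γ _ h).trans (key γ' _ rfl).symm)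

theorem exists_monodromy_eq [PathConnectedSpace Xt] {x y : X} (e : π ⁻¹' {x}) (z : π ⁻¹' {y}) :
    ∃ γ : Path.Homotopic.Quotient x y, hπ.monodromy γ e = z := by
  obtain ⟨e, rfl⟩ := e
  obtain ⟨z, rfl⟩ := z
  exact ⟨_, hπ.monodromy_map (.mk (PathConnectedSpace.somePath e z))⟩

end IsCoveringMap

namespace FreedmanQuinn

section Deck

variable {X Xt : Type*} [TopologicalSpace X] [TopologicalSpace Xt] [SimplyConnectedSpace Xt]
  {π : Xt → X} (hπ : IsCoveringMap π) {xt₀ : Xt} {x₀ : X} (h₀ : π xt₀ = x₀)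

/-- Simple connectivity makes the path chosen in `deck` irrelevant. Every point of the cover is the
endpoint of a lifted class, so the action can now be computed with path classes. -/
theorem deck_monodromy (g : FundamentalGroup X x₀) {y : X} (γ : Path.Homotopic.Quotient x₀ y) :
    deck hπ h₀ g (hπ.monodromy γ ⟨xt₀, h₀⟩) =
      hπ.monodromy (Path.Homotopic.Quotient.trans g.toPath γ) ⟨xt₀, h₀⟩ := by
  subst h₀
  generalize hz : hπ.monodromy γ ⟨xt₀, rfl⟩ = z
  obtain ⟨z, rfl⟩ := z
  have hγ : γ = Path.Homotopic.Quotient.map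
      (.mk (PathConnectedSpace.somePath xt₀ z)) ⟨π, hπ.continuous⟩ :=
    hπ.eq_of_monodromy_eq (hz.trans (hπ.monodromy_map _).symm)
  subst hγ
  have hg : g.toPath = Path.Homotopic.Quotient.mk (Quotient.out g.toPath) :=
    (Quotient.out_eq g.toPath).symm
  rw [hg]
  rfl

/-- With z the endpoint of the lift of γ, the lifts of gγ and hγ end at the same point, so gγ = hγ,
and γ cancels. -/
theorem deck_injective {g h : FundamentalGroup X x₀} {z : Xt}
    (hgh : deck hπ h₀ g z = deck hπ h₀ h z) : g = h := by
  obtain ⟨γ, hγ⟩ := hπ.exists_monodromy_eq (⟨xt₀, h₀⟩ : π ⁻¹' {x₀}) (⟨z, rfl⟩ : π ⁻¹' {π z})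
  have hz : z = hπ.monodromy γ ⟨xt₀, h₀⟩ := by rw [hγ]
  rw [hz, deck_monodromy, deck_monodromy] at hgh
  exact Path.Homotopic.Quotient.trans_right_cancel (hπ.eq_of_monodromy_eq (Subtype.ext hgh))

theorem deck_one (z : Xt) : deck hπ h₀ 1 z = z := by
  obtain ⟨γ, hγ⟩ := hπ.exists_monodromy_eq (⟨xt₀, h₀⟩ : π ⁻¹' {x₀}) (⟨z, rfl⟩ : π ⁻¹' {π z})
  have hz : z = hπ.monodromy γ ⟨xt₀, h₀⟩ := by rw [hγ]
  rw [hz, deck_monodromy, FundamentalGroup.one_def]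
  exact congrArg (fun q => (hπ.monodromy q _ : Xt)) (Path.Homotopic.Quotient.refl_trans γ)

theorem proj_deck (g : FundamentalGroup X x₀) (z : Xt) : π (deck hπ h₀ g z) = π z := by
  obtain ⟨γ, hγ⟩ := hπ.exists_monodromy_eq (⟨xt₀, h₀⟩ : π ⁻¹' {x₀}) (⟨z, rfl⟩ : π ⁻¹' {π z})
  have hz : z = hπ.monodromy γ ⟨xt₀, h₀⟩ := by rw [hγ]
  have h := deck_monodromy hπ h₀ g γ
  rw [← hz] at h
  rw [h]
  exact (hπ.monodromy _ _).2

theorem deck_deck_of_mem_twoTorsion {g : FundamentalGroup X x₀} (hg : g ∈ twoTorsion x₀) (z : Xt) :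
    deck hπ h₀ g (deck hπ h₀ g z) = z := by
  obtain ⟨γ, hγ⟩ := hπ.exists_monodromy_eq (⟨xt₀, h₀⟩ : π ⁻¹' {x₀}) (⟨z, rfl⟩ : π ⁻¹' {π z})
  have hz : z = hπ.monodromy γ ⟨xt₀, h₀⟩ := by rw [hγ]
  have hgg : Path.Homotopic.Quotient.trans g.toPath g.toPath = .refl x₀ := by
    have := hg.1
    rwa [sq] at this
  rw [hz, deck_monodromy, deck_monodromy, ← Path.Homotopic.Quotient.trans_assoc, hgg,
    Path.Homotopic.Quotient.refl_trans]

end Deck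

section DoubleLoop

variable {X Xt M V : Type*} [TopologicalSpace X] [TopologicalSpace Xt] [SimplyConnectedSpace Xt]
  [TopologicalSpace M] [TopologicalSpace V]
  {π : Xt → X} (hπ : IsCoveringMap π) {xt₀ : Xt} {x₀ : X} (h₀ : π xt₀ = x₀)

/-- The deck transformation of the loop of a double point takes one lifted sheet to the other. -/
theorem deck_doubleLoop {m₀ : M} {F : C(M, X × V)} {Ft : C(M, Xt × V)}
    (hFt : IsBasedLift π xt₀ m₀ F Ft) (hF₀ : (F m₀).1 = x₀) {x y : M} (hxy : F x = F y)
    (a : Path m₀ x) (b : Path x y) :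
    deck hπ h₀ (FundamentalGroup.fromPath (.mk (doubleLoop F hF₀ hxy a b))) (Ft x).1 =
      (Ft y).1 := by
  obtain ⟨hl, hb⟩ := hFt
  -- Replacing F by the projection of Ft turns the image arcs into projections of arcs in the cover,
  -- whose lifts are known.
  obtain rfl : (ContinuousMap.prodMap ⟨π, hπ.continuous⟩ (ContinuousMap.id V)).comp Ft = F :=
    ContinuousMap.ext hl
  subst hb
  subst h₀
  let ψ : C(M, Xt) := ContinuousMap.fst.comp Ft
  let p : C(Xt, X) := ⟨π, hπ.continuous⟩
  have ha := hπ.monodromy_map (.mk (a.map ψ.continuous))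
  have hab := hπ.monodromy_map ((Path.Homotopic.Quotient.mk
    ((a.map ψ.continuous).trans (b.map ψ.continuous))))
  have hd := deck_monodromy hπ (rfl : π (Ft m₀).1 = π (Ft m₀).1)
    (FundamentalGroup.fromPath (.mk (doubleLoop _ hF₀ hxy a b)))
    (.map (.mk (a.map ψ.continuous)) p)
  have hx : ((hπ.monodromy (.map (.mk (a.map ψ.continuous)) p) ⟨(Ft m₀).1, rfl⟩ : π ⁻¹' _) : Xt) =
    (Ft x).1 := congrArg Subtype.val ha
  have hy : ((hπ.monodromy (.map (.mk ((a.map ψ.continuous).trans (b.map ψ.continuous))) p)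
    ⟨(Ft m₀).1, rfl⟩ : π ⁻¹' _) : Xt) = (Ft y).1 := congrArg Subtype.val hab
  have hxy' : π (Ft y).1 = π (Ft x).1 := (congrArg Prod.fst hxy).symm
  have hq := Path.Homotopic.Quotient.conj_trans_cancel
    (Path.Homotopic.Quotient.map (.mk (a.map ψ.continuous)) p)
    (Path.Homotopic.Quotient.map (.mk (b.map ψ.continuous)) p) hxy'
  refine (congrArg _ hx.symm).trans (hd.trans (Eq.trans ?_ hy))
  refine (congrArg (fun q => (hπ.monodromy q ⟨(Ft m₀).1, rfl⟩ : Xt)) hq).trans ?_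
  refine (hπ.coe_monodromy_cast _ _ _).trans ?_
  rw [← Path.Homotopic.Quotient.mk_map, ← Path.Homotopic.Quotient.mk_map,
    ← Path.Homotopic.Quotient.mk_map, ← Path.Homotopic.Quotient.mk_trans, ← Path.map_trans]
  rfl

end DoubleLoop

end FreedmanQuinn

/-! ### Counting double points in the universal cover -/

namespace FreedmanQuinn

section Pairs

variable {M N : Type*} {F : M → N}

theorem finite_doublePoints (hfin : (doublePairs F).Finite) : (doublePoints F).Finite := by
  refine (hfin.image fun q => F q.1).subset ?_
  rintro p ⟨x, y, hne, hx, hy⟩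
  exact ⟨(x, y), ⟨hne, hx.trans hy.symm⟩, hx⟩

/-- The chosen preimages of a double point. -/
noncomputable def preimagePair (p : doublePoints F) : M × M :=
  (p.2.choose, p.2.choose_spec.choose)

theorem preimagePair_ne (p : doublePoints F) : (preimagePair p).1 ≠ (preimagePair p).2 :=
  p.2.choose_spec.choose_spec.1

theorem map_preimagePair_fst (p : doublePoints F) : F (preimagePair p).1 = p :=
  p.2.choose_spec.choose_spec.2.1

theorem map_preimagePair_snd (p : doublePoints F) : F (preimagePair p).2 = p :=
  p.2.choose_spec.choose_spec.2.2

theorem preimagePair_injective : Function.Injective (preimagePair (F := F)) := fun p q h =>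
  Subtype.ext ((map_preimagePair_fst p).symm.trans
    ((congrArg (fun r => F r.1) h).trans (map_preimagePair_fst q)))

end Pairs

section Count

variable {X Xt M V : Type*} [TopologicalSpace X] [TopologicalSpace Xt] [SimplyConnectedSpace Xt]
  [TopologicalSpace M] [TopologicalSpace V]
  {π : Xt → X} (hπ : IsCoveringMap π) {xt₀ : Xt} {x₀ : X} (h₀ : π xt₀ = x₀)
  {m₀ : M} {F : C(M, X × V)} {Ft : C(M, Xt × V)}

/-- The pairs of points with the same image under `F` whose lifts are related by the deck
transformation of `g`. -/
def sheetPairs (F : C(M, X × V)) (Ft : C(M, Xt × V)) (g : FundamentalGroup X x₀) : Set (M × M) :=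
  {q ∈ doublePairs F | deck hπ h₀ g (Ft q.1).1 = (Ft q.2).1}

theorem eq_one_of_deck_eq_self {g : FundamentalGroup X x₀} {z : Xt} (h : deck hπ h₀ g z = z) :
    g = 1 :=
  deck_injective hπ h₀ (h.trans (deck_one hπ h₀ z).symm)

/-- If Ft y = g · Ft x, projecting gives F x = F y, and freeness with g ≠ 1 excludes x = y. -/
theorem meet_eq_image_sheetPairs (hFt : IsBasedLift π xt₀ m₀ F Ft) {g : FundamentalGroup X x₀}
    (hg : g ≠ 1) : meet hπ h₀ Ft g = (fun q => Ft q.2) '' sheetPairs hπ h₀ F Ft g := by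
  ext r
  constructor
  · rintro ⟨⟨y, rfl⟩, _, ⟨x, rfl⟩, hxy⟩
    have h1 : deck hπ h₀ g (Ft x).1 = (Ft y).1 := congrArg Prod.fst hxy
    have h2 : (Ft x).2 = (Ft y).2 := (Prod.ext_iff.mp hxy).2
    refine ⟨(x, y), ⟨⟨?_, ?_⟩, h1⟩, rfl⟩
    · rintro (rfl : x = y)
      exact hg (eq_one_of_deck_eq_self hπ h₀ h1)
    · change F x = F y
      rw [← hFt.lifts x, ← hFt.lifts y]
      exact Prod.ext ((proj_deck hπ h₀ g _).symm.trans (congrArg π h1)) h2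
  · rintro ⟨⟨x, y⟩, ⟨⟨-, hxy⟩, hd⟩, rfl⟩
    refine ⟨⟨y, rfl⟩, Ft x, ⟨x, rfl⟩, Prod.ext hd ?_⟩
    have h : F x = F y := hxy
    rw [← hFt.lifts x, ← hFt.lifts y] at h
    exact (Prod.ext_iff.mp h).2

theorem injOn_sheetPairs
    (htriple : ∀ x y z, F x = F y → F y = F z → x = y ∨ y = z ∨ x = z)
    (hFt : IsBasedLift π xt₀ m₀ F Ft) {g : FundamentalGroup X x₀} (hg : g ≠ 1) :
    InjOn (fun q => Ft q.2) (sheetPairs hπ h₀ F Ft g) := by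
  rintro ⟨x, y⟩ ⟨⟨hne, hxy⟩, hd⟩ ⟨x', y'⟩ ⟨⟨hne', hxy'⟩, -⟩ (hy : Ft y = Ft y')
  dsimp only at hne hxy hd hne' hxy'
  have hyF : F y = F y' := by rw [← hFt.lifts y, ← hFt.lifts y', hy]
  have hyy : y = y' := by
    rcases htriple y y' x hyF (hyF.symm.trans hxy.symm) with h | h | h
    · exact h
    -- Here y' = x, so g · Ft x = Ft y = Ft x and g would fix a point.
    · subst h
      exact (hg (eq_one_of_deck_eq_self hπ h₀ (hd.trans (congrArg Prod.fst hy)))).elim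
    · exact (hne h.symm).elim
  subst hyy
  rcases htriple x x' y (hxy.trans hxy'.symm) hxy' with h | h | h
  · rw [h]
  · exact (hne' h).elim
  · exact (hne h).elim

theorem coverSum_apply (h : HasIsolatedDoublePoints hπ h₀ F Ft) (g : twoTorsion x₀) :
    coverSum hπ h₀ Ft g = (((meet hπ h₀ Ft g.1).ncard / 2 : ℕ) : ZMod 2) := by
  -- Needed because `finsum` is zero by default on infinite support.
  have hsupp : (Function.support fun g : twoTorsion x₀ =>
      Finsupp.single g (((meet hπ h₀ Ft g.1).ncard / 2 : ℕ) : ZMod 2)).Finite := by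
    refine (h.finitely_many.preimage (f := Subtype.val)
      Subtype.val_injective.injOn).subset fun k hk => ⟨k.2.2, ?_⟩
    by_contra hne
    rw [not_nonempty_iff_eq_empty] at hne
    exact hk (by simp [hne])
  have hmap := (Finsupp.applyAddHom (M := ZMod 2) g).map_finsum hsupp
  simp only [Finsupp.applyAddHom_apply] at hmap
  rw [coverSum, hmap, finsum_eq_single _ g fun k hk => by simp [hk]]
  simp

variable [PathConnectedSpace M]

theorem deck_doubleElt (hFt : IsBasedLift π xt₀ m₀ F Ft) (hF₀ : (F m₀).1 = x₀)
    (p : doublePoints F) :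
    deck hπ h₀ (doubleElt F hF₀ p) (Ft (preimagePair p).1).1 = (Ft (preimagePair p).2).1 :=
  deck_doubleLoop hπ h₀ hFt hF₀ _ _ _

/-- A double point has exactly two ordered pairs of preimages. They have inverse elements, which
agree when g² = 1, so the order chosen in `doubleElt` does not matter. -/
theorem sheetPairs_eq_union
    (htriple : ∀ x y z, F x = F y → F y = F z → x = y ∨ y = z ∨ x = z)
    (hFt : IsBasedLift π xt₀ m₀ F Ft) (hF₀ : (F m₀).1 = x₀) {g : FundamentalGroup X x₀}
    (hg : g ∈ twoTorsion x₀) :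
    sheetPairs hπ h₀ F Ft g = preimagePair '' {p | doubleElt F hF₀ p = g} ∪
      (Prod.swap ∘ preimagePair) '' {p | doubleElt F hF₀ p = g} := by
  ext ⟨x, y⟩
  constructor
  · rintro ⟨⟨hne, hxy⟩, hd⟩
    dsimp only at hne hxy hd
    let p : doublePoints F := ⟨F x, x, y, hne, rfl, hxy.symm⟩
    have hp := deck_doubleElt hπ h₀ hFt hF₀ p
    have hne' := preimagePair_ne p
    have ha : F (preimagePair p).1 = F x := map_preimagePair_fst p
    have hb : F (preimagePair p).2 = F x := map_preimagePair_snd p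
    generalize hab : preimagePair p = q at hp hne' ha hb
    obtain ⟨a, b⟩ := q
    dsimp only at hp hne' ha hb
    have hxab : x = a ∨ x = b := by
      rcases htriple a b x (ha.trans hb.symm) hb with h | h | h
      exacts [(hne' h).elim, .inr h.symm, .inl h.symm]
    have hyab : y = a ∨ y = b := by
      rcases htriple a b y (ha.trans hb.symm) (hb.trans hxy) with h | h | h
      exacts [(hne' h).elim, .inr h.symm, .inl h.symm]
    rcases hxab with rfl | rfl <;> rcases hyab with rfl | rfl
    · exact (hne rfl).elim
    · exact .inl ⟨p, deck_injective hπ h₀ (hp.trans hd.symm), hab⟩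
    · refine .inr ⟨p, deck_injective hπ h₀ (hp.trans ?_), by simp [hab]⟩
      rw [← hd, deck_deck_of_mem_twoTorsion hπ h₀ hg]
    · exact (hne rfl).elim
  · have hmem : ∀ p : doublePoints F, doubleElt F hF₀ p = g →
        preimagePair p ∈ sheetPairs hπ h₀ F Ft g := by
      rintro p rfl
      exact ⟨⟨preimagePair_ne p, (map_preimagePair_fst p).trans (map_preimagePair_snd p).symm⟩,
        deck_doubleElt hπ h₀ hFt hF₀ p⟩
    rintro (⟨p, hp, h⟩ | ⟨p, hp, h⟩)
    · exact h ▸ hmem p hp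
    · obtain ⟨⟨hne, hxy⟩, hd⟩ := hmem p hp
      rw [← h]
      refine ⟨⟨hne.symm, hxy.symm⟩, ?_⟩
      simp only [Function.comp_apply, Prod.fst_swap, Prod.snd_swap]
      rw [← hd, deck_deck_of_mem_twoTorsion hπ h₀ hg]

/-- Every double point with element `g ∈ T_X` gives two points of `Y_1 ∩ Y_g`. -/
theorem ncard_meet (hfin : (doublePairs F).Finite)
    (htriple : ∀ x y z, F x = F y → F y = F z → x = y ∨ y = z ∨ x = z)
    (hFt : IsBasedLift π xt₀ m₀ F Ft) (hF₀ : (F m₀).1 = x₀) {g : FundamentalGroup X x₀}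
    (hg : g ∈ twoTorsion x₀) :
    (meet hπ h₀ Ft g).ncard = 2 * {p : doublePoints F | doubleElt F hF₀ p = g}.ncard := by
  have : Finite (doublePoints F) := finite_doublePoints hfin
  rw [meet_eq_image_sheetPairs hπ h₀ hFt hg.2,
    (injOn_sheetPairs hπ h₀ htriple hFt hg.2).ncard_image,
    sheetPairs_eq_union hπ h₀ htriple hFt hF₀ hg, ncard_union_eq ?_ (toFinite _) (toFinite _),
    ncard_image_of_injective _ preimagePair_injective,
    ncard_image_of_injective _ (Prod.swap_injective.comp preimagePair_injective), two_mul]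
  -- A common pair has a single image under F, so it comes from one double point and equals its own
  -- swap, against x ≠ y.
  rw [Set.disjoint_left]
  rintro _ ⟨p, -, rfl⟩ ⟨p', -, h⟩
  have hpp : p' = p := by
    refine Subtype.ext ?_
    rw [← map_preimagePair_snd p', ← map_preimagePair_fst p, ← h]
    rfl
  subst hpp
  exact preimagePair_ne p' (congrArg Prod.snd h)

theorem hasIsolatedDoublePoints (hfin : (doublePairs F).Finite)
    (htriple : ∀ x y z, F x = F y → F y = F z → x = y ∨ y = z ∨ x = z)
    (hFt : IsBasedLift π xt₀ m₀ F Ft) (hF₀ : (F m₀).1 = x₀) :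
    HasIsolatedDoublePoints hπ h₀ F Ft where
  base := finite_doublePoints hfin
  lift := by
    refine finite_doublePoints (hfin.subset fun q hq => ⟨hq.1, ?_⟩)
    rw [← hFt.lifts, ← hFt.lifts, hq.2]
  meet_finite g hg := by
    rw [meet_eq_image_sheetPairs hπ h₀ hFt hg]
    exact (hfin.subset fun q hq => hq.1).image _
  finitely_many := by
    -- By freeness each of the finitely many double pairs is matched by at most one g.
    refine (hfin.biUnion (t := fun q => {g | deck hπ h₀ g (Ft q.1).1 = (Ft q.2).1})
      fun q _ => Set.Subsingleton.finite fun g hg h hh =>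
        deck_injective hπ h₀ (Eq.trans hg (Eq.symm hh))).subset ?_
    rintro g ⟨hg, hne⟩
    rw [meet_eq_image_sheetPairs hπ h₀ hFt hg, image_nonempty] at hne
    obtain ⟨q, hq, hd⟩ := hne
    exact mem_biUnion hq hd
  meet_even g hg := by
    rw [ncard_meet hπ h₀ hfin htriple hFt hF₀ hg]
    exact even_two_mul _

theorem selfIntersection_apply (hfin : (doublePairs F).Finite) (hF₀ : (F m₀).1 = x₀)
    (g : twoTorsion x₀) :
    selfIntersection F hF₀ g = ({p : doublePoints F | doubleElt F hF₀ p = g}.ncard : ZMod 2) := by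
  classical
  have : Finite (doublePoints F) := finite_doublePoints hfin
  have := Fintype.ofFinite (doublePoints F)
  rw [selfIntersection, finsum_eq_sum_of_fintype, Finsupp.finsetSum_apply,
    Set.ncard_eq_toFinset_card', Set.toFinset_ofPred, ← Finset.sum_boole]
  refine Finset.sum_congr rfl fun p _ => ?_
  by_cases h : doubleElt F hF₀ p ∈ twoTorsion x₀
  · simp only [dif_pos h, Finsupp.single_apply, Subtype.ext_iff]
  · rw [dif_neg h, if_neg fun hp : doubleElt F hF₀ p = g => h (hp ▸ g.2), Finsupp.coe_zero, Pi.zero_apply]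

/-- The self-intersection sum counts half the intersections of the translates of the lift. -/
theorem selfIntersection_eq_coverSum (hfin : (doublePairs F).Finite)
    (htriple : ∀ x y z, F x = F y → F y = F z → x = y ∨ y = z ∨ x = z)
    (hFt : IsBasedLift π xt₀ m₀ F Ft) (hF₀ : (F m₀).1 = x₀) :
    selfIntersection F hF₀ = coverSum hπ h₀ Ft := by
  ext g
  rw [selfIntersection_apply hfin,
    coverSum_apply hπ h₀ (hasIsolatedDoublePoints hπ h₀ hfin htriple hFt hF₀),
    ncard_meet hπ h₀ hfin htriple hFt hF₀ g.2, Nat.mul_div_cancel_left _ two_pos]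

end Count

end FreedmanQuinn

theorem proposition4p4 {HX X Xt : Type*} [TopologicalSpace HX]
    (I : ModelWithCorners ℝ (EuclideanSpace ℝ (Fin 4)) HX)
    [TopologicalSpace X] [T2Space X] [ConnectedSpace X] [ChartedSpace HX X] [IsManifold I ∞ X]
    [TopologicalSpace Xt] [SimplyConnectedSpace Xt]
    (π : Xt → X) (hπ : IsCoveringMap π) (xt₀ : Xt) (x₀ : X) (h₀ : π xt₀ = x₀) :
    (∀ (f : C(Sph 3, X × Plane)) (hf : IsGenericSphere I x₀ f) (ft : C(Sph 3, Xt × Plane)),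
      IsBasedLift π xt₀ (pole 3) f ft →
        HasIsolatedDoublePoints hπ h₀ f ft ∧ mu3 hf = coverSum hπ h₀ ft) ∧
    (∀ (S₀ S₁ : Sph 2 → X), IsBasedSphere I x₀ S₀ → IsBasedSphere I x₀ S₁ →
      ∀ (H : C(Sph 2 × unitInterval, X × (ℝ × unitInterval)))
        (hH : IsGenericTrack I x₀ S₀ S₁ H)
        (Ht : C(Sph 2 × unitInterval, Xt × (ℝ × unitInterval))),
        IsBasedLift π xt₀ (pole 2, 0) H Ht →
          HasIsolatedDoublePoints hπ h₀ H Ht ∧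
            fq hH = (mu3Image I x₀).mkQ (coverSum hπ h₀ Ht)) := by
  constructor
  · intro f hf ft hft
    have hfin := hf.generic.finite_doublePairs (by simp)
    exact ⟨hasIsolatedDoublePoints hπ h₀ hfin hf.generic.no_triple hft hf.based,
      selfIntersection_eq_coverSum hπ h₀ hfin hf.generic.no_triple hft hf.based⟩
  · intro S₀ S₁ _ _ H hH Ht hHt
    -- `simp` checks the dimensions, 4 + (1 + 1) = 2 · (2 + 1).
    have hfin := hH.generic.finite_doublePairs (by simp)
    exact ⟨hasIsolatedDoublePoints hπ h₀ hfin hH.generic.no_triple hHt (hH.based 0),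
      -- The equality already holds in 𝔽₂ T_X for this H, before the quotient is taken.
      congrArg _ (selfIntersection_eq_coverSum hπ h₀ hfin hH.generic.no_triple hHt (hH.based 0))⟩
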